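/- Let $R$ be a unital (not necessarily commutative) ring and let $(E,\omega)$ be a row-finite weighted graph: a set $E^0$ of vertices, a set $E^{\mathrm{st}}$ of structured edges, maps $s,r:E^{\mathrm{st}}\to E^0$ such that $s^{-1}(v)$ is finite for every $v\in E^0$, and a weight map $\omega:E^{\mathrm{st}}\to\{1,2,3,\dots\}$. Let $E^1=\{\alpha_i\mid \alpha\in E^{\mathrm{st}},\ 1\le i\le\omega(\alpha)\}$ and $(E^1)^*=\{\alpha_i^*\mid \alpha_i\in E^1\}$, let $X=E^0\sqcup E^1\sqcup (E^1)^*$, and let $R\langle X\rangle$ be the free left $R$-module on the set of nonempty words over $X$, with the multiplication $(\sum_x r_x x)(\sum_y s_y y)=\sum_{x,y} r_xs_y\,xy$ and the $R$-bimodule structure in which $R$ commutes with the words. The weighted Leavitt path algebra $L_R(E,\omega)$ is the quotient of $R\langle X\rangle$ by the two-sided ideal and $R$-subbimodule generated by the relations (1) $vw=\delta_{vw}v$ for $v,w\in E^0$; (2) $s(\alpha)\alpha_i=\alpha_i r(\alpha)=\alpha_i$ and $r(\alpha)\alpha_i^*=\alpha_i^*s(\alpha)=\alpha_i^*$ for $\alpha\in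 E^{\mathrm{st}}$, $1\le i\le\omega(\alpha)$; (3) $\sum_{\alpha\in s^{-1}(v)}\alpha_i\alpha_j^*=\delta_{ij}v$ for $v\in E^0$ with $s^{-1}(v)\neq\emptyset$ and $1\le i,j\le\max\{\omega(\alpha)\mid s(\alpha)=v\}$; (4) $\sum_{1\le i\le\max\{\omega(\alpha),\omega(\beta)\}}\alpha_i^*\beta_i=\delta_{\alpha\beta}r(\alpha)$ for $\alpha,\beta\in E^{\mathrm{st}}$; where in (3) and (4) $\alpha_i$ and $\alpha_i^*$ are read as $0$ if $i>\omega(\alpha)$. For every vertex $v$ which is not a sink (that is, $s^{-1}(v)\ne\emptyset$) fix $\alpha^v\in s^{-1}(v)$ with $\omega(\alpha^v)=\max\{\omega(\alpha)\mid s(\alpha)=v\}$. Put $s(\alpha_i)=s(\alpha)=r(\alpha_i^*)$ and $r(\alpha_i)=r(\alpha)=s(\alpha_i^*)$. A generalised path is a word over $X$ which is either a single vertex or of the form $x_1\dots x_n$ with $n\ge1$, $x_1,\dots,x_n\in E^1\cup(E^1)^*$ and $r(x_i)=s(x_{i+1})$ for $1\le i\le n-1$. It is called normal if it contains as a (contiguous)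 subword none of the words $\alpha^v_i(\alpha^v_j)^*$ (where $v\in E^0$ is not a sink and $1\le i,j\le\omega(\alpha^v)$) and none of the words $\alpha_1^*\beta_1$ (where $\alpha,\beta\in E^{\mathrm{st}}$). Then $L_R(E,\omega)$ is a free left $R$-module, and the family of the images in $L_R(E,\omega)$ of the normal generalised paths, indexed by the normal generalised paths, is a basis of it. -/

import Mathlib

universe u₁ u₂ u₃

set_option linter.checkUnivs false

/-! ### Ideals of `R`-rings (possibly non-unital rings with an `R`-bimodule structure) -/

section RRing

variable (R : Type*) [Ring R] {A : Type*} [NonUnitalRing A] [Module R A] [Module Rᵐᵒᵖ A]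

/-- A two-sided ideal of the (non-unital) ring `A` is an ideal of the `R`-ring `A` if it is
moreover an `R`-subbimodule of `A`. -/
def IsRRingIdeal (J : TwoSidedIdeal A) : Prop :=
  (∀ (r : R) (x : A), x ∈ J → r • x ∈ J) ∧
    ∀ (r : R) (x : A), x ∈ J → MulOpposite.op r • x ∈ J

/-- The ideal of the `R`-ring `A` generated by the set `s`. -/
def rRingIdealSpan (s : Set A) : TwoSidedIdeal A :=
  sInf {J : TwoSidedIdeal A | s ⊆ (J : Set A) ∧ IsRRingIdeal R J}

theorem isRRingIdeal_rRingIdealSpan (s : Set A) : IsRRingIdeal R (rRingIdealSpan R s) := by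
  constructor
  · intro r x hx
    rw [rRingIdealSpan, TwoSidedIdeal.mem_sInf] at hx ⊢
    exact fun J hJ => hJ.2.1 r x (hx J hJ)
  · intro r x hx
    rw [rRingIdealSpan, TwoSidedIdeal.mem_sInf] at hx ⊢
    exact fun J hJ => hJ.2.2 r x (hx J hJ)

end RRing

/-! ### Weighted graphs -/

/-- A weighted graph: vertices, structured edges with source and range, and positive integer
weights.  The set of edges consists of the symbols `α_1, …, α_{ω(α)}` for each structured
edge `α`. -/
structure WeightedGraph where
  /-- The vertices. -/
  Vertex : Type u₁
  /-- The structured edges. -/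
  SEdge : Type u₂
  /-- The source map. -/
  source : SEdge → Vertex
  /-- The range map. -/
  range : SEdge → Vertex
  /-- The weight map. -/
  weight : SEdge → ℕ
  /-- Weights are positive. -/
  weight_pos : ∀ α, 0 < weight α

namespace WeightedGraph

variable (E : WeightedGraph.{u₁, u₂})

/-- Every vertex emits only finitely many structured edges. -/
class RowFinite : Prop where
  /-- The fibres of the source map are finite. -/
  finite_out : ∀ v : E.Vertex, {α : E.SEdge | E.source α = v}.Finite

/-- The finite set of structured edges emitted by `v`. -/
noncomputable def out [E.RowFinite] (v : E.Vertex) : Finset E.SEdge :=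
  (RowFinite.finite_out v).toFinset

/-- `ω(v)`, the maximum of the weights of the structured edges emitted by `v`
(and `0` if there are none). -/
noncomputable def vertexWeight [E.RowFinite] (v : E.Vertex) : ℕ :=
  (E.out v).sup E.weight

/-- A vertex is a sink if it emits no structured edge. -/
def IsSink (v : E.Vertex) : Prop := ∀ α : E.SEdge, E.source α ≠ v

/-- The alphabet: the disjoint union of the vertices `v`, the edges `α_i` and the ghost edges
`α_i^*`.  The index `i : Fin (ω α)` is zero-based, so that it stands for `α_{i+1}`. -/
inductive Letter : Type max u₁ u₂
  | vertex (v : E.Vertex) : Letter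
  | edge (α : E.SEdge) (i : Fin (E.weight α)) : Letter
  | ghost (α : E.SEdge) (i : Fin (E.weight α)) : Letter

variable {E}

namespace Letter

/-- The source of a letter. -/
def src : E.Letter → E.Vertex
  | vertex v => v
  | edge α _ => E.source α
  | ghost α _ => E.range α

/-- The range of a letter. -/
def rng : E.Letter → E.Vertex
  | vertex v => v
  | edge α _ => E.range α
  | ghost α _ => E.source α

/-- The letter is a vertex. -/
def IsVertex (x : E.Letter) : Prop := ∃ v : E.Vertex, x = vertex v

end Letter

variable (E)

/-- Nonempty words over the alphabet. -/
abbrev Word : Type max u₁ u₂ := FreeSemigroup E.Letter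

variable {E}

/-- The list of letters of a word. -/
def Word.letters (p : E.Word) : List E.Letter := p.head :: p.tail

/-- `A` is a (contiguous) subword of `p`. -/
def Word.IsSubword (A p : E.Word) : Prop := A.letters <:+: p.letters

/-- Generalised paths: either a single vertex, or a nonempty word in edges and ghost edges in
which the range of each letter is the source of the next one. -/
def Word.IsGeneralisedPath (p : E.Word) : Prop :=
  (∃ v : E.Vertex, p = FreeSemigroup.of (Letter.vertex v)) ∨
    ((∀ x ∈ p.letters, ¬ x.IsVertex) ∧ p.letters.IsChain (fun x y => x.rng = y.src))

variable (E)

/-- A choice, for each vertex `v` which is not a sink, of a structured edge `α^v` emitted by `v`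
whose weight is maximal among all structured edges emitted by `v`. -/
structure SpecialEdges where
  /-- The structured edge `α^v`. -/
  edge : {v : E.Vertex // ¬ E.IsSink v} → E.SEdge
  /-- `α^v` is emitted by `v`. -/
  source_edge : ∀ v, E.source (edge v) = v.1
  /-- The weight of `α^v` is maximal. -/
  weight_le : ∀ v, ∀ β : E.SEdge, E.source β = v.1 → E.weight β ≤ E.weight (edge v)

variable {E}

/-- Words of type I: `α^v_i (α^v_j)^*`. -/
def Word.IsTypeI (a : E.SpecialEdges) (A : E.Word) : Prop :=
  ∃ (v : {v : E.Vertex // ¬ E.IsSink v}) (i j : Fin (E.weight (a.edge v))),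
    A = FreeSemigroup.of (Letter.edge (a.edge v) i) * FreeSemigroup.of (Letter.ghost (a.edge v) j)

/-- Words of type II: `α_1^* β_1`. -/
def Word.IsTypeII (A : E.Word) : Prop :=
  ∃ α β : E.SEdge,
    A = FreeSemigroup.of (Letter.ghost α ⟨0, E.weight_pos α⟩) *
      FreeSemigroup.of (Letter.edge β ⟨0, E.weight_pos β⟩)

/-- A generalised path is normal if it contains no subword of type I or type II. -/
def Word.IsNormal (a : E.SpecialEdges) (p : E.Word) : Prop :=
  p.IsGeneralisedPath ∧ ∀ A : E.Word, A.IsTypeI a ∨ A.IsTypeII → ¬ A.IsSubword p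

/-! ### Weighted Leavitt path algebras -/

variable (R : Type u₃) [Ring R] (E)

/-- The free `R`-ring on the alphabet: the free left `R`-module on the nonempty words with the
product `(∑ r_x x) (∑ s_y y) = ∑ r_x s_y xy`. -/
abbrev FreeRRing : Type max u₁ u₂ u₃ := MonoidAlgebra R E.Word

variable {E}

/-- A word, as an element of the free `R`-ring. -/
noncomputable def ofWord (p : E.Word) : E.FreeRRing R := MonoidAlgebra.single p 1

/-- The vertex `v` in the free `R`-ring. -/
noncomputable def vert (v : E.Vertex) : E.FreeRRing R :=
  ofWord R (FreeSemigroup.of (Letter.vertex v))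

/-- The element `α_{i+1}` of the free `R`-ring, with the convention that it is zero if
`i + 1 > ω(α)`. -/
noncomputable def edgeElt (α : E.SEdge) (i : ℕ) : E.FreeRRing R :=
  if h : i < E.weight α then ofWord R (FreeSemigroup.of (Letter.edge α ⟨i, h⟩)) else 0

/-- The element `α_{i+1}^*` of the free `R`-ring, with the convention that it is zero if
`i + 1 > ω(α)`. -/
noncomputable def ghostElt (α : E.SEdge) (i : ℕ) : E.FreeRRing R :=
  if h : i < E.weight α then ofWord R (FreeSemigroup.of (Letter.ghost α ⟨i, h⟩)) else 0

variable (E) [E.RowFinite]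

open Classical in
/-- The defining relations (left-hand side, right-hand side) of the weighted Leavitt path
algebra. Indices are zero-based. -/
inductive LeavittRel : E.FreeRRing R → E.FreeRRing R → Prop
  | vertex_mul_vertex (v w : E.Vertex) :
      LeavittRel (vert R v * vert R w) (if v = w then vert R v else 0)
  | source_mul_edge (α : E.SEdge) (i : ℕ) (hi : i < E.weight α) :
      LeavittRel (vert R (E.source α) * edgeElt R α i) (edgeElt R α i)
  | edge_mul_range (α : E.SEdge) (i : ℕ) (hi : i < E.weight α) :
      LeavittRel (edgeElt R α i * vert R (E.range α)) (edgeElt R α i)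
  | range_mul_ghost (α : E.SEdge) (i : ℕ) (hi : i < E.weight α) :
      LeavittRel (vert R (E.range α) * ghostElt R α i) (ghostElt R α i)
  | ghost_mul_source (α : E.SEdge) (i : ℕ) (hi : i < E.weight α) :
      LeavittRel (ghostElt R α i * vert R (E.source α)) (ghostElt R α i)
  | sum_edge_mul_ghost (v : E.Vertex) (i j : ℕ) (hi : i < E.vertexWeight v)
      (hj : j < E.vertexWeight v) :
      LeavittRel (∑ α ∈ E.out v, edgeElt R α i * ghostElt R α j) (if i = j then vert R v else 0)
  | sum_ghost_mul_edge (α β : E.SEdge) :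
      LeavittRel (∑ i ∈ Finset.range (max (E.weight α) (E.weight β)),
        ghostElt R α i * edgeElt R β i) (if α = β then vert R (E.range α) else 0)

/-- The ideal of the free `R`-ring generated by the defining relations. -/
noncomputable def leavittIdeal : TwoSidedIdeal (E.FreeRRing R) :=
  rRingIdealSpan R {x | ∃ l r : E.FreeRRing R, LeavittRel E R l r ∧ x = l - r}

/-- The weighted Leavitt path algebra `L_R(E, ω)`: the quotient of the free `R`-ring by the
ideal generated by the defining relations. -/
def LeavittPathAlgebra : Type max u₁ u₂ u₃ := (leavittIdeal E R).ringCon.Quotient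

namespace LeavittPathAlgebra

/-- The (non-unital) ring structure of the quotient. -/
noncomputable instance : NonUnitalRing (LeavittPathAlgebra E R) :=
  { (inferInstance : NonUnitalSemiring (leavittIdeal E R).ringCon.Quotient),
    (inferInstance : AddCommGroup (leavittIdeal E R).ringCon.Quotient) with }

/-- The quotient map. -/
noncomputable def mk : E.FreeRRing R →ₙ+* LeavittPathAlgebra E R where
  toFun x := (x : (leavittIdeal E R).ringCon.Quotient)
  map_mul' _ _ := rfl
  map_zero' := rfl
  map_add' _ _ := rfl

theorem mk_surjective : Function.Surjective (mk E R) := Quotient.mk''_surjective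

theorem mk_eq_mk {x y : E.FreeRRing R} : mk E R x = mk E R y ↔ x - y ∈ leavittIdeal E R :=
  ((leavittIdeal E R).ringCon.eq).trans (TwoSidedIdeal.rel_iff _ _ _)

/-- The left scalar multiplication, induced from the free `R`-ring. -/
noncomputable instance : SMul R (LeavittPathAlgebra E R) where
  smul r := Quotient.map' (r • ·) fun x y h => by
    have h' := (isRRingIdeal_rRingIdealSpan R _).1 r _ ((TwoSidedIdeal.rel_iff _ _ _).1 h)
    rw [smul_sub] at h'
    exact (TwoSidedIdeal.rel_iff _ _ _).2 h'

/-- The right scalar multiplication, induced from the free `R`-ring. -/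
noncomputable instance : SMul Rᵐᵒᵖ (LeavittPathAlgebra E R) where
  smul r := Quotient.map' (r • ·) fun x y h => by
    have h' := (isRRingIdeal_rRingIdealSpan R _).2 r.unop _ ((TwoSidedIdeal.rel_iff _ _ _).1 h)
    rw [MulOpposite.op_unop, smul_sub] at h'
    exact (TwoSidedIdeal.rel_iff _ _ _).2 h'

/-- The left `R`-module structure. -/
noncomputable instance : Module R (LeavittPathAlgebra E R) :=
  Function.Surjective.module R (mk E R : E.FreeRRing R →+ LeavittPathAlgebra E R)
    (mk_surjective E R) fun _ _ => rfl

/-- The right `R`-module structure. -/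
noncomputable instance : Module Rᵐᵒᵖ (LeavittPathAlgebra E R) :=
  Function.Surjective.module Rᵐᵒᵖ (mk E R : E.FreeRRing R →+ LeavittPathAlgebra E R)
    (mk_surjective E R) fun _ _ => rfl

end LeavittPathAlgebra

end WeightedGraph

/-! Orient the relations as rewriting rules: (3) is solved for the product of two letters of the
chosen edge `α^v`, and (4) for the product of two first letters. Subscripts in the comments below
are zero-based, as in the code, so the first letters are `α_0^*` and `β_0`.

Independence comes from a representation rather than from a confluence argument. For each vertex
`t`, every letter acts on the free module on lists by prepending itself and applying one rule if a
forbidden pair appears. One rule is enough: what it produces from a normal path is again normal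
(`edgeOp_single_mem`, `ghostOp_single_mem`). The only critical cases are the overlaps `α_i α_0^*
β_0` and `α_i^* β_i β_j^*` with `β` special; `sum_edgeOp_ghostOp` and `sum_ghostOp_edgeOp` verify
relations (3) and (4) there. So the ideal annihilates the span of the normal paths ending at `t`. A
normal path applied to the trivial path at its end returns itself (`wordOp_pathWord`), so
coefficients can be read off.

For spanning, the operators are dictated by the relations, so the map from lists to the algebra
turns them into left multiplication (`mk_letter_mul_pathMap`). Every word is its own action on a
trivial path, hence is a combination of normal paths. -/

namespace WeightedGraph

section

variable {E : WeightedGraph.{u₁, u₂}} (a : E.SpecialEdges) (t : E.Vertex)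

/-! ### Normal lists of edges and ghost edges ending at a fixed vertex -/

/-- `α` is the chosen edge of its source. -/
def SpecialEdges.IsSpecial (α : E.SEdge) : Prop := ∃ v, a.edge v = α

variable {a} in
theorem SpecialEdges.IsSpecial.eq {α β : E.SEdge} (hα : a.IsSpecial α) (hβ : a.IsSpecial β)
    (h : E.source α = E.source β) : α = β := by
  obtain ⟨v, rfl⟩ := hα
  obtain ⟨w, rfl⟩ := hβ
  rw [a.source_edge, a.source_edge] at h
  rw [Subtype.ext h]

variable {a} in
theorem SpecialEdges.IsSpecial.weight_le {α β : E.SEdge} (hα : a.IsSpecial α)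
    (h : E.source β = E.source α) : E.weight β ≤ E.weight α := by
  obtain ⟨v, rfl⟩ := hα
  exact a.weight_le v β (h.trans (a.source_edge v))

/-- The pairs of letters which are not allowed to be adjacent in a normal path. -/
inductive IsForbidden : E.Letter → E.Letter → Prop
  | edge_ghost (α : E.SEdge) (i j : Fin (E.weight α)) (h : a.IsSpecial α) :
      IsForbidden (.edge α i) (.ghost α j)
  | ghost_edge (α β : E.SEdge) :
      IsForbidden (.ghost α ⟨0, E.weight_pos α⟩) (.edge β ⟨0, E.weight_pos β⟩)

/-- The source of the path with letters `l` and end vertex `t`. -/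
def pathSource : List E.Letter → E.Vertex
  | [] => t
  | x :: _ => x.src

@[simp] theorem pathSource_nil : pathSource t [] = t := rfl

@[simp] theorem pathSource_cons (x : E.Letter) (l : List E.Letter) :
    pathSource t (x :: l) = x.src := rfl

/-- The list `l` of edges and ghost edges is a normal path with end vertex `t`. -/
inductive IsNormalTo : List E.Letter → Prop
  | nil : IsNormalTo []
  | cons (x : E.Letter) (l : List E.Letter) (hx : ¬ x.IsVertex) (hr : x.rng = pathSource t l)
      (hf : ∀ y ∈ l.head?, ¬ IsForbidden a x y) (hl : IsNormalTo l) : IsNormalTo (x :: l)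

theorem Letter.not_isVertex_edge (α : E.SEdge) (i : Fin (E.weight α)) :
    ¬ (Letter.edge α i).IsVertex := by
  rintro ⟨v, hv⟩; cases hv

theorem Letter.not_isVertex_ghost (α : E.SEdge) (i : Fin (E.weight α)) :
    ¬ (Letter.ghost α i).IsVertex := by
  rintro ⟨v, hv⟩; cases hv

/-! ### The action of the letters on paths -/

variable (R : Type u₃) [Ring R]

/-- Formal prepending of `α_{i+1}` (zero if `i + 1 > ω(α)`). -/
noncomputable def consEdge (α : E.SEdge) (i : ℕ) :
    (List E.Letter →₀ R) →ₗ[R] (List E.Letter →₀ R) :=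
  if h : i < E.weight α then Finsupp.lmapDomain R R (List.cons (.edge α ⟨i, h⟩)) else 0

/-- Formal prepending of `α_{i+1}^*` (zero if `i + 1 > ω(α)`). -/
noncomputable def consGhost (α : E.SEdge) (i : ℕ) :
    (List E.Letter →₀ R) →ₗ[R] (List E.Letter →₀ R) :=
  if h : i < E.weight α then Finsupp.lmapDomain R R (List.cons (.ghost α ⟨i, h⟩)) else 0

theorem consEdge_single {α : E.SEdge} {i : ℕ} (h : i < E.weight α) (l : List E.Letter) :
    consEdge R α i (.single l 1) = .single (.edge α ⟨i, h⟩ :: l) 1 := by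
  simp [consEdge, h]

theorem consGhost_single {α : E.SEdge} {i : ℕ} (h : i < E.weight α) (l : List E.Letter) :
    consGhost R α i (.single l 1) = .single (.ghost α ⟨i, h⟩ :: l) 1 := by
  simp [consGhost, h]

theorem consEdge_of_le {α : E.SEdge} {i : ℕ} (h : E.weight α ≤ i) : consEdge R α i = 0 := by
  simp [consEdge, h]

theorem consGhost_of_le {α : E.SEdge} {i : ℕ} (h : E.weight α ≤ i) : consGhost R α i = 0 := by
  simp [consGhost, h]

open Classical in
/-- The action of a vertex on a path. -/
noncomputable def vertexAct (u : E.Vertex) (l : List E.Letter) : List E.Letter →₀ R :=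
  if pathSource t l = u then .single l 1 else 0

open Classical in
/-- The action of `α_{i+1}^*` on a path: prepend, and reduce once if necessary. -/
noncomputable def ghostAct (α : E.SEdge) (i : ℕ) : List E.Letter → (List E.Letter →₀ R)
  | .edge β j :: l =>
    if E.source β = E.source α then
      if i = 0 ∧ (j : ℕ) = 0 then
        (if α = β then .single l 1 else 0) -
          ∑ k ∈ Finset.Ico 1 (E.weight β), consGhost R α k (consEdge R β k (.single l 1))
      else consGhost R α i (.single (.edge β j :: l) 1)
    else 0
  | l => if pathSource t l = E.source α then consGhost R α i (.single l 1) else 0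

/-- The linear extension of `vertexAct`. -/
noncomputable def vertexOp (u : E.Vertex) : Module.End R (List E.Letter →₀ R) :=
  Finsupp.linearCombination R (vertexAct t R u)

/-- The linear extension of `ghostAct`. -/
noncomputable def ghostOp (α : E.SEdge) (i : ℕ) : Module.End R (List E.Letter →₀ R) :=
  Finsupp.linearCombination R (ghostAct t R α i)

variable {t}

theorem vertexOp_single_self {u : E.Vertex} {l : List E.Letter} (h : pathSource t l = u) :
    vertexOp t R u (.single l 1) = .single l 1 := by
  simp [vertexOp, vertexAct, h]

theorem vertexOp_single_of_ne {u : E.Vertex} {l : List E.Letter} (h : pathSource t l ≠ u) :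
    vertexOp t R u (.single l 1) = 0 := by
  simp [vertexOp, vertexAct, h]

theorem ghostOp_single_of_ne {α : E.SEdge} {l : List E.Letter} (h : pathSource t l ≠ E.source α)
    (i : ℕ) : ghostOp t R α i (.single l 1) = 0 := by
  simp only [ghostOp, Finsupp.linearCombination_single, one_smul]
  unfold ghostAct
  split
  · exact if_neg h
  · exact if_neg h

theorem ghostOp_single_of_not_first {α : E.SEdge} {i : ℕ} {l : List E.Letter}
    (h : pathSource t l = E.source α)
    (hs : i = 0 → ∀ β l', l ≠ .edge β ⟨0, E.weight_pos β⟩ :: l') :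
    ghostOp t R α i (.single l 1) = consGhost R α i (.single l 1) := by
  simp only [ghostOp, Finsupp.linearCombination_single, one_smul]
  unfold ghostAct
  split
  · rename_i β j l
    rw [if_pos (show E.source _ = _ from h), if_neg]
    rintro ⟨h', h''⟩
    exact hs h' β l (by simp [Fin.ext_iff, h''])
  · exact if_pos h

/-- Weights are positive, so an index out of range is nonzero and the reducing case never arises.
This matches the convention `α_i^* = 0` in the relations. -/
theorem ghostOp_of_le {α : E.SEdge} {i : ℕ} (h : E.weight α ≤ i) : ghostOp t R α i = 0 := by
  refine Finsupp.lhom_ext' fun l => LinearMap.ext_ring ?_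
  change ghostOp t R α i (.single l 1) = 0
  by_cases hl : pathSource t l = E.source α
  · have := E.weight_pos α
    rw [ghostOp_single_of_not_first R hl (by omega), consGhost_of_le R h, LinearMap.zero_apply]
  · exact ghostOp_single_of_ne R hl i

/-- This is relation (4) solved for `α_0^* β_0`. Stopping at `ω(β)` instead of the maximum loses
nothing, since `β_k = 0` from there on. -/
theorem ghostOp_single_first [DecidableEq E.SEdge] {α β : E.SEdge} (h : E.source β = E.source α)
    (l : List E.Letter) :
    ghostOp t R α 0 (.single (.edge β ⟨0, E.weight_pos β⟩ :: l) 1) =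
      (if α = β then .single l 1 else 0) -
        ∑ k ∈ Finset.Ico 1 (E.weight β), consGhost R α k (consEdge R β k (.single l 1)) := by
  simp only [ghostOp, Finsupp.linearCombination_single, one_smul]
  unfold ghostAct
  simp only [if_true, h, and_self]
  congr!

/-! ### The action preserves normality -/

variable (t) in
/-- The span of the normal paths from `u` to `t`. -/
def normalSpan (u : E.Vertex) : Submodule R (List E.Letter →₀ R) :=
  Finsupp.supported R R {l | IsNormalTo a t l ∧ pathSource t l = u}

variable (t) in
/-- The span of the normal paths ending at `t`. -/
def normalSpanTo : Submodule R (List E.Letter →₀ R) := Finsupp.supported R R {l | IsNormalTo a t l}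

variable (t) in
theorem normalSpan_le (u : E.Vertex) : normalSpan a t R u ≤ normalSpanTo a t R :=
  Finsupp.supported_mono fun _ h => h.1

theorem normalSpanTo_induction {P : (List E.Letter →₀ R) → Prop} {m : List E.Letter →₀ R}
    (hm : m ∈ normalSpanTo a t R) (single : ∀ l, IsNormalTo a t l → P (.single l 1))
    (zero : P 0) (add : ∀ x y, P x → P y → P (x + y)) (smul : ∀ (r : R) x, P x → P (r • x)) :
    P m := by
  rw [normalSpanTo, Finsupp.supported_eq_span_single] at hm
  induction hm using Submodule.span_induction with
  | mem x hx =>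
    obtain ⟨l, hl, rfl⟩ := hx
    exact single l hl
  | zero => exact zero
  | add x y _ _ hx hy => exact add x y hx hy
  | smul r x _ hx => exact smul r x hx

variable {a} in
theorem single_mem_normalSpan {l : List E.Letter} (hl : IsNormalTo a t l) :
    (Finsupp.single l 1 : List E.Letter →₀ R) ∈ normalSpan a t R (pathSource t l) :=
  Finsupp.single_mem_supported R 1 ⟨hl, rfl⟩

theorem consEdge_single_mem {α : E.SEdge} {l : List E.Letter} (i : ℕ) (hl : IsNormalTo a t l)
    (h : pathSource t l = E.range α) (hs : a.IsSpecial α → ∀ j l', l ≠ .ghost α j :: l') :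
    consEdge R α i (.single l 1) ∈ normalSpan a t R (E.source α) := by
  by_cases hi : i < E.weight α
  · rw [consEdge_single R hi]
    refine single_mem_normalSpan R (.cons _ _ (Letter.not_isVertex_edge _ _) h.symm ?_ hl)
    rintro y hy hf
    obtain ⟨l', rfl⟩ := List.head?_eq_some_iff.1 hy
    cases hf with
    | edge_ghost α i j h' => exact hs h' _ _ rfl
  · simp [consEdge_of_le R (not_lt.1 hi)]

variable {a} in
theorem IsNormalTo.cons_ghost {α : E.SEdge} {l : List E.Letter} {i : ℕ} (hi : i < E.weight α)
    (hl : IsNormalTo a t l) (h : pathSource t l = E.source α)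
    (hs : i = 0 → ∀ β l', l ≠ .edge β ⟨0, E.weight_pos β⟩ :: l') :
    IsNormalTo a t (.ghost α ⟨i, hi⟩ :: l) := by
  refine .cons _ _ (Letter.not_isVertex_ghost _ _) h.symm ?_ hl
  -- The index must be a variable for case analysis to unify it with the zero index in `ghost_edge`.
  generalize hx : (⟨i, hi⟩ : Fin _) = k
  rintro y hy hf
  obtain ⟨l', rfl⟩ := List.head?_eq_some_iff.1 hy
  cases hf with
  | ghost_edge α β => exact hs (Fin.mk.inj_iff.1 hx) _ _ rfl

theorem consGhost_single_mem {α : E.SEdge} {l : List E.Letter} {i : ℕ} (hl : IsNormalTo a t l)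
    (h : pathSource t l = E.source α)
    (hs : i = 0 → ∀ β l', l ≠ .edge β ⟨0, E.weight_pos β⟩ :: l') :
    consGhost R α i (.single l 1) ∈ normalSpan a t R (E.range α) := by
  by_cases hi : i < E.weight α
  · rw [consGhost_single R hi]
    exact single_mem_normalSpan R (hl.cons_ghost hi h hs)
  · simp [consGhost_of_le R (not_lt.1 hi)]

/-- A single reduction ends in normal paths. In `α_k^* β_k l` with `k ≥ 1` the first pair is allowed
because `k ≠ 0`. The second is allowed because whether an edge may precede a ghost does not depend
on the indices, and `β_0 l` was normal. -/
theorem ghostOp_single_mem (α : E.SEdge) (i : ℕ) {l : List E.Letter} (hl : IsNormalTo a t l) :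
    ghostOp t R α i (.single l 1) ∈ normalSpan a t R (E.range α) := by
  classical
  by_cases h : pathSource t l = E.source α
  swap
  · simp [ghostOp_single_of_ne R h]
  by_cases hs : i = 0 ∧ ∃ β l', l = .edge β ⟨0, E.weight_pos β⟩ :: l'
  swap
  · push Not at hs
    rw [ghostOp_single_of_not_first R h hs]
    exact consGhost_single_mem a R hl h hs
  obtain ⟨rfl, β, l, rfl⟩ := hs
  rw [ghostOp_single_first R h]
  obtain _ | ⟨_, _, _, hr, hf, hl'⟩ := hl
  refine sub_mem ?_ (sum_mem fun k hk => ?_)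
  · split_ifs with hβ
    · subst hβ
      have := single_mem_normalSpan R hl'
      rwa [← hr] at this
    · exact zero_mem _
  · rw [Finset.mem_Ico] at hk
    rw [consEdge_single R hk.2]
    refine consGhost_single_mem a R (.cons _ _ (Letter.not_isVertex_edge _ _) hr ?_ hl') h ?_
    · rintro y hy hf'
      obtain ⟨l', rfl⟩ := List.head?_eq_some_iff.1 hy
      cases hf' with
      | edge_ghost α i j h' => exact hf _ rfl (.edge_ghost _ _ _ h')
    · omega

theorem vertexOp_single_mem (u : E.Vertex) {l : List E.Letter} (hl : IsNormalTo a t l) :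
    vertexOp t R u (.single l 1) ∈ normalSpan a t R u := by
  by_cases h : pathSource t l = u
  · rw [vertexOp_single_self R h, ← h]
    exact single_mem_normalSpan R hl
  · simp [vertexOp_single_of_ne R h]

theorem vertexOp_of_mem {u : E.Vertex} {m : List E.Letter →₀ R} (hm : m ∈ normalSpan a t R u) :
    vertexOp t R u m = m := by
  rw [normalSpan, Finsupp.supported_eq_span_single] at hm
  induction hm using Submodule.span_induction with
  | mem x hx =>
    obtain ⟨l, hl, rfl⟩ := hx
    exact vertexOp_single_self R hl.2
  | zero => simp
  | add x y _ _ hx hy => simp [hx, hy]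
  | smul r x _ hx => simp [hx]

theorem vertexOp_of_mem_of_ne {u v : E.Vertex} (h : v ≠ u) {m : List E.Letter →₀ R}
    (hm : m ∈ normalSpan a t R v) : vertexOp t R u m = 0 := by
  rw [normalSpan, Finsupp.supported_eq_span_single] at hm
  induction hm using Submodule.span_induction with
  | mem x hx =>
    obtain ⟨l, hl, rfl⟩ := hx
    exact vertexOp_single_of_ne R (hl.2 ▸ h)
  | zero => simp
  | add x y _ _ hx hy => simp [hx, hy]
  | smul r x _ hx => simp [hx]

/-! ### The defining relations hold on normal paths -/

theorem exists_special {α : E.SEdge} {v : E.Vertex} (h : E.source α = v) :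
    ∃ β, a.IsSpecial β ∧ E.source β = v :=
  ⟨a.edge ⟨v, fun hv => hv α h⟩, ⟨_, rfl⟩, a.source_edge _⟩

/-- Relation (4) when prepending `β_i` needs no reduction: only the term `i = 0` is then rewritten,
and its correction cancels all the others. -/
theorem sum_ghostOp_consEdge [DecidableEq E.SEdge] (α β : E.SEdge) {n : ℕ} (hn : E.weight β ≤ n)
    (l : List E.Letter) :
    ∑ i ∈ Finset.range n, ghostOp t R α i (consEdge R β i (.single l 1)) =
      if α = β then .single l 1 else 0 := by
  by_cases h : E.source β = E.source α
  swap
  · rw [if_neg (by rintro rfl; exact h rfl)]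
    refine Finset.sum_eq_zero fun i _ => ?_
    by_cases hi : i < E.weight β
    · rw [consEdge_single R hi]
      exact ghostOp_single_of_ne R (l := .edge β ⟨i, hi⟩ :: l) h i
    · simp [consEdge_of_le R (not_lt.1 hi)]
  have h0 := E.weight_pos β
  rw [← Finset.sum_subset (Finset.range_subset_range.2 hn) fun i _ hi => by
      rw [consEdge_of_le R (by simpa using hi)]; simp,
    Finset.range_eq_Ico, Finset.sum_eq_sum_Ico_succ_bot h0, consEdge_single R h0,
    ghostOp_single_first R h, sub_add_eq_add_sub, sub_eq_iff_eq_add]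
  congr 1
  refine Finset.sum_congr rfl fun k hk => ?_
  rw [Finset.mem_Ico] at hk
  rw [consEdge_single R hk.2]
  exact ghostOp_single_of_not_first R h (by omega)

/-! ### The operators of the edges, and relations (3) and (4) -/

variable [E.RowFinite]

@[simp] theorem mem_out {α : E.SEdge} {v : E.Vertex} : α ∈ E.out v ↔ E.source α = v := by
  simp [out]

variable (t) in
open Classical in
/-- The action of `α_{i+1}` on a path: prepend, and reduce once if necessary. -/
noncomputable def edgeAct (α : E.SEdge) (i : ℕ) : List E.Letter → (List E.Letter →₀ R)
  | .ghost β j :: l =>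
    if E.range β = E.range α then
      if β = α ∧ a.IsSpecial α then
        (if i = j then .single l 1 else 0) -
          ∑ γ ∈ (E.out (E.source α)).erase α, consEdge R γ i (consGhost R γ j (.single l 1))
      else consEdge R α i (.single (.ghost β j :: l) 1)
    else 0
  | l => if pathSource t l = E.range α then consEdge R α i (.single l 1) else 0

variable (t) in
/-- The linear extension of `edgeAct`. -/
noncomputable def edgeOp (α : E.SEdge) (i : ℕ) : Module.End R (List E.Letter →₀ R) :=
  Finsupp.linearCombination R (edgeAct a t R α i)

theorem edgeOp_single_of_ne {α : E.SEdge} {l : List E.Letter} (h : pathSource t l ≠ E.range α)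
    (i : ℕ) : edgeOp a t R α i (.single l 1) = 0 := by
  simp only [edgeOp, Finsupp.linearCombination_single, one_smul]
  unfold edgeAct
  split
  · exact if_neg h
  · exact if_neg h

theorem edgeOp_single_of_not_special {α : E.SEdge} {l : List E.Letter}
    (h : pathSource t l = E.range α)
    (hs : a.IsSpecial α → ∀ j l', l ≠ .ghost α j :: l') (i : ℕ) :
    edgeOp a t R α i (.single l 1) = consEdge R α i (.single l 1) := by
  simp only [edgeOp, Finsupp.linearCombination_single, one_smul]
  unfold edgeAct
  split
  · rw [if_pos (show E.range _ = _ from h), if_neg]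
    rintro ⟨rfl, h'⟩
    exact hs h' _ _ rfl
  · exact if_pos h

/-- This is relation (3) solved for the special summand; row-finiteness makes the correction a
finite sum. -/
theorem edgeOp_single_special [DecidableEq E.SEdge] {α : E.SEdge} (hα : a.IsSpecial α) (i : ℕ)
    (j : Fin (E.weight α)) (l : List E.Letter) :
    edgeOp a t R α i (.single (.ghost α j :: l) 1) = (if i = j then .single l 1 else 0) -
      ∑ γ ∈ (E.out (E.source α)).erase α, consEdge R γ i (consGhost R γ j (.single l 1)) := by
  simp only [edgeOp, Finsupp.linearCombination_single, one_smul]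
  unfold edgeAct
  simp only [if_true, hα, and_self]
  congr!

/-- Again one reduction suffices. In `γ_i γ_j^* l` the edge `γ` shares its source with the special
`α` and differs from it, so it is not special. The pair formed by `γ_j^*` and the head of `l` could
be forbidden only if `α_j^*` already formed a forbidden pair there. -/
theorem edgeOp_single_mem (α : E.SEdge) (i : ℕ) {l : List E.Letter} (hl : IsNormalTo a t l) :
    edgeOp a t R α i (.single l 1) ∈ normalSpan a t R (E.source α) := by
  classical
  by_cases h : pathSource t l = E.range α
  swap
  · simp [edgeOp_single_of_ne a R h]
  by_cases hs : a.IsSpecial α ∧ ∃ j l', l = .ghost α j :: l'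
  swap
  · push Not at hs
    rw [edgeOp_single_of_not_special a R h hs]
    exact consEdge_single_mem a R i hl h hs
  obtain ⟨hα, j, l, rfl⟩ := hs
  rw [edgeOp_single_special a R hα]
  obtain _ | ⟨_, _, _, hr, hf, hl'⟩ := hl
  refine sub_mem ?_ (sum_mem fun γ hγ => ?_)
  · split_ifs
    · have := single_mem_normalSpan R hl'
      rwa [← hr] at this
    · exact zero_mem _
  · rw [Finset.mem_erase, mem_out] at hγ
    by_cases hj : (j : ℕ) < E.weight γ
    swap
    · simp [consGhost_of_le R (not_lt.1 hj)]
    have hj' : (j : ℕ) = 0 → ∀ β l', l ≠ .edge β ⟨0, E.weight_pos β⟩ :: l' := by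
      rintro h0 β l' rfl
      have : j = ⟨0, E.weight_pos α⟩ := Fin.ext h0
      subst this
      exact hf _ rfl (.ghost_edge α β)
    rw [consGhost_single R hj, ← hγ.2]
    refine consEdge_single_mem a R i (hl'.cons_ghost hj (hr.symm.trans hγ.2.symm) hj') rfl fun hγ' k l' hk => ?_
    exact hγ.1 (hγ'.eq hα hγ.2)

theorem exists_source_eq_of_lt {v : E.Vertex} {i : ℕ} (h : i < E.vertexWeight v) :
    ∃ α, E.source α = v ∧ i < E.weight α := by
  simpa [vertexWeight, Finset.lt_sup_iff] using h

variable {a} in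
theorem SpecialEdges.IsSpecial.vertexWeight_le {α : E.SEdge} (hα : a.IsSpecial α) :
    E.vertexWeight (E.source α) ≤ E.weight α :=
  Finset.sup_le fun _ hβ => hα.weight_le (mem_out.1 hβ)

/-- Relation (3) when prepending `α_j^*` needs no reduction: only the special edge is rewritten, and
its correction cancels the other summands. Maximality of its weight guarantees that its `j`-th ghost
exists. -/
theorem sum_edgeOp_consGhost {v : E.Vertex} (i : ℕ) {j : ℕ} (hj : j < E.vertexWeight v)
    (l : List E.Letter) :
    ∑ α ∈ E.out v, edgeOp a t R α i (consGhost R α j (.single l 1)) =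
      if i = j then .single l 1 else 0 := by
  classical
  obtain ⟨β, hβ, -⟩ := exists_source_eq_of_lt hj
  obtain ⟨α, hα, rfl⟩ := exists_special a hβ
  rw [← Finset.add_sum_erase _ _ (mem_out.2 rfl),
    consGhost_single R (hj.trans_le hα.vertexWeight_le), edgeOp_single_special a R hα,
    sub_add_eq_add_sub, sub_eq_iff_eq_add]
  congr 1
  refine Finset.sum_congr rfl fun γ hγ => ?_
  rw [Finset.mem_erase, mem_out] at hγ
  by_cases hj' : j < E.weight γ
  · rw [consGhost_single R hj']
    exact edgeOp_single_of_not_special a R rfl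
      (fun hs => absurd (hs.eq hα hγ.2) hγ.1) i
  · simp [consGhost_of_le R (not_lt.1 hj')]

/-- The overlap is `α_i α_0^* β_0 l`. Rewriting the ghost pair and summing over `α` leaves `β_i l -
∑_{k ≥ 1} δ_{ik} β_k l`, which is `β_0 l` for `i = 0` and zero otherwise. -/
theorem sum_edgeOp_ghostOp [DecidableEq E.Vertex] {v : E.Vertex} (i : ℕ) {j : ℕ}
    (hj : j < E.vertexWeight v) {l : List E.Letter} (hl : IsNormalTo a t l) :
    ∑ α ∈ E.out v, edgeOp a t R α i (ghostOp t R α j (.single l 1)) =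
      if i = j then vertexOp t R v (.single l 1) else 0 := by
  classical
  by_cases h : pathSource t l = v
  swap
  · rw [vertexOp_single_of_ne R h, ite_self]
    refine Finset.sum_eq_zero fun α hα => ?_
    rw [ghostOp_single_of_ne R (by rwa [mem_out.1 hα]), map_zero]
  rw [vertexOp_single_self R h]
  by_cases hs : j = 0 ∧ ∃ β l', l = .edge β ⟨0, E.weight_pos β⟩ :: l'
  swap
  · push Not at hs
    rw [← sum_edgeOp_consGhost a R i hj l]
    refine Finset.sum_congr rfl fun α hα => ?_
    rw [ghostOp_single_of_not_first R (h.trans (mem_out.1 hα).symm) hs]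
  obtain ⟨rfl, β, l, rfl⟩ := hs
  obtain _ | ⟨_, _, _, hr, hf, hl'⟩ := hl
  change E.source β = v at h
  have hb : ∀ k ∈ Finset.Ico 1 (E.weight β),
      ∑ α ∈ E.out v, edgeOp a t R α i (consGhost R α k (consEdge R β k (.single l 1))) =
        if i = k then consEdge R β k (.single l 1) else 0 := by
    intro k hk
    rw [Finset.mem_Ico] at hk
    rw [consEdge_single R hk.2]
    exact sum_edgeOp_consGhost a R i
      (hk.2.trans_le (Finset.le_sup (f := E.weight) (mem_out.2 h))) _
  -- Since `β_0 l` is normal, `β_i` meets no forbidden ghost at the head of `l`.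
  have he : edgeOp a t R β i (.single l 1) = consEdge R β i (.single l 1) :=
    edgeOp_single_of_not_special a R hr.symm
      (by rintro hs j l' rfl; exact hf _ rfl (.edge_ghost _ _ _ hs)) i
  have hsum : ∀ α ∈ E.out v,
      edgeOp a t R α i (ghostOp t R α 0 (.single (.edge β ⟨0, E.weight_pos β⟩ :: l) 1)) =
        (if α = β then edgeOp a t R α i (.single l 1) else 0) - ∑ k ∈ Finset.Ico 1 (E.weight β),
          edgeOp a t R α i (consGhost R α k (consEdge R β k (.single l 1))) := by
    intro α hα
    rw [ghostOp_single_first R (h.trans (mem_out.1 hα).symm), map_sub, map_sum]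
    split_ifs <;> simp
  rw [Finset.sum_congr rfl hsum, Finset.sum_sub_distrib, Finset.sum_ite_eq',
    if_pos (mem_out.2 h), Finset.sum_comm, Finset.sum_congr rfl hb, he, Finset.sum_ite_eq,
    ← consEdge_single R (E.weight_pos β)]
  rcases Nat.eq_zero_or_pos i with rfl | hi
  · simp
  · rw [if_neg hi.ne']
    by_cases hi' : i < E.weight β
    · rw [if_pos (Finset.mem_Ico.2 ⟨hi, hi'⟩), sub_self]
    · simp [consEdge_of_le R (not_lt.1 hi')]

/-- The overlap is `α_i^* β_i β_j^* l` with `β` special. Rewriting the edge pair and summing over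
`i` leaves `α_j^* l` minus `∑_{γ ≠ β} δ_{αγ} γ_j^* l`. The terms cancel if `α ≠ β` has the source of
`β`; if the sources differ, both vanish. -/
theorem sum_ghostOp_edgeOp [DecidableEq E.SEdge] (α β : E.SEdge) {n : ℕ} (hn : E.weight β ≤ n)
    {l : List E.Letter} (hl : IsNormalTo a t l) :
    ∑ i ∈ Finset.range n, ghostOp t R α i (edgeOp a t R β i (.single l 1)) =
      if α = β then vertexOp t R (E.range α) (.single l 1) else 0 := by
  by_cases h : pathSource t l = E.range β
  swap
  · rw [Finset.sum_eq_zero fun i _ => by rw [edgeOp_single_of_ne a R h, map_zero]]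
    split_ifs with hαβ
    · rw [hαβ, vertexOp_single_of_ne R h]
    · rfl
  rw [show (if α = β then vertexOp t R (E.range α) (.single l 1) else 0) =
      if α = β then (.single l 1 : List E.Letter →₀ R) else 0 by
    split_ifs with hαβ
    · rw [hαβ, vertexOp_single_self R h]
    · rfl]
  by_cases hs : a.IsSpecial β ∧ ∃ j l', l = .ghost β j :: l'
  swap
  · push Not at hs
    rw [← sum_ghostOp_consEdge R α β hn l]
    refine Finset.sum_congr rfl fun i _ => ?_
    rw [edgeOp_single_of_not_special a R h hs]
  obtain ⟨hβ, j, l, rfl⟩ := hs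
  obtain _ | ⟨_, _, _, hr, hf, hl'⟩ := hl
  change E.source β = _ at hr
  have hb : ∀ γ ∈ (E.out (E.source β)).erase β,
      ∑ i ∈ Finset.range n, ghostOp t R α i (consEdge R γ i (consGhost R γ j (.single l 1))) =
        if α = γ then consGhost R γ j (.single l 1) else 0 := by
    intro γ hγ
    rw [Finset.mem_erase, mem_out] at hγ
    by_cases hj : (j : ℕ) < E.weight γ
    · rw [consGhost_single R hj]
      -- Maximality of `ω(β)` makes the range of `i` long enough for every `γ`.
      exact sum_ghostOp_consEdge R α γ ((hβ.weight_le hγ.2).trans hn) _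
    · simp [consGhost_of_le R (not_lt.1 hj)]
  have hsum : ∀ i ∈ Finset.range n,
      ghostOp t R α i (edgeOp a t R β i (.single (.ghost β j :: l) 1)) =
        (if i = j then ghostOp t R α i (.single l 1) else 0) -
          ∑ γ ∈ (E.out (E.source β)).erase β,
            ghostOp t R α i (consEdge R γ i (consGhost R γ j (.single l 1))) := by
    intro i _
    rw [edgeOp_single_special a R hβ, map_sub, map_sum]
    split_ifs <;> simp
  rw [Finset.sum_congr rfl hsum, Finset.sum_sub_distrib, Finset.sum_ite_eq',
    if_pos (Finset.mem_range.2 (j.2.trans_le hn)), Finset.sum_comm, Finset.sum_congr rfl hb,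
    Finset.sum_ite_eq]
  have hmem : α ∈ (E.out (E.source β)).erase β ↔ α ≠ β ∧ E.source α = E.source β := by
    rw [Finset.mem_erase, mem_out]
  by_cases hα : E.source α = E.source β
  · rw [ghostOp_single_of_not_first R (hr.symm.trans hα.symm)]
    · by_cases hαβ : α = β
      · subst hαβ
        rw [if_neg fun h => (hmem.1 h).1 rfl, if_pos rfl, consGhost_single R j.2, sub_zero]
      · rw [if_pos (hmem.2 ⟨hαβ, hα⟩), if_neg hαβ, sub_self]
    · rintro h0 γ l' rfl
      have : j = ⟨0, E.weight_pos β⟩ := Fin.ext h0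
      subst this
      exact hf _ rfl (.ghost_edge β γ)
  · rw [ghostOp_single_of_ne R (by rw [← hr]; exact Ne.symm hα), if_neg fun h => hα (hmem.1 h).2,
      if_neg (show α ≠ β from fun h => hα (h ▸ rfl)), sub_zero]

end

section

variable {E : WeightedGraph.{u₁, u₂}} (a : E.SpecialEdges) {t : E.Vertex} (R : Type u₃) [Ring R]
  [E.RowFinite]

/-! ### The action of the free `R`-ring -/

/-- In the reducing case the correction vanishes as well, because no `γ` with the same source
outweighs a special `α`. -/
theorem edgeOp_of_le {α : E.SEdge} {i : ℕ} (h : E.weight α ≤ i) : edgeOp a t R α i = 0 := by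
  classical
  refine Finsupp.lhom_ext' fun l => LinearMap.ext_ring ?_
  change edgeOp a t R α i (.single l 1) = 0
  by_cases hl : pathSource t l = E.range α
  swap
  · exact edgeOp_single_of_ne a R hl i
  by_cases hs : a.IsSpecial α ∧ ∃ j l', l = .ghost α j :: l'
  swap
  · push Not at hs
    rw [edgeOp_single_of_not_special a R hl hs, consEdge_of_le R h, LinearMap.zero_apply]
  obtain ⟨hα, j, l, rfl⟩ := hs
  rw [edgeOp_single_special a R hα, if_neg (by have := j.2; omega), zero_sub, neg_eq_zero]
  refine Finset.sum_eq_zero fun γ hγ => ?_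
  rw [Finset.mem_erase, mem_out] at hγ
  rw [consEdge_of_le R ((hα.weight_le hγ.2).trans h), LinearMap.zero_apply]

variable (t)

/-- The operator by which a letter acts. -/
noncomputable def letterOp : E.Letter → Module.End R (List E.Letter →₀ R)
  | .vertex u => vertexOp t R u
  | .edge α i => edgeOp a t R α i
  | .ghost α i => ghostOp t R α i

/-- The operator by which a word acts. -/
noncomputable def wordOp : E.Word →ₙ* Module.End R (List E.Letter →₀ R) :=
  FreeSemigroup.lift (letterOp a t R)

/-- The evaluation of the action of the free `R`-ring at `m`. -/
noncomputable def evalAt (m : List E.Letter →₀ R) : E.FreeRRing R →ₗ[R] (List E.Letter →₀ R) :=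
  Finsupp.linearCombination R (fun p => wordOp a t R p m) ∘ₗ
    (MonoidAlgebra.coeffLinearEquiv R).toLinearMap

variable {t}

theorem evalAt_single (m : List E.Letter →₀ R) (p : E.Word) (r : R) :
    evalAt a t R m (MonoidAlgebra.single p r) = r • wordOp a t R p m := by
  simp [evalAt]

theorem evalAt_ofWord (m : List E.Letter →₀ R) (p : E.Word) :
    evalAt a t R m (ofWord R p) = wordOp a t R p m := by
  rw [ofWord, evalAt_single, one_smul]

theorem evalAt_add (m m' : List E.Letter →₀ R) (f : E.FreeRRing R) :
    evalAt a t R (m + m') f = evalAt a t R m f + evalAt a t R m' f := by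
  induction f using MonoidAlgebra.induction_linear with
  | zero => simp
  | add f g hf hg => simp only [map_add, hf, hg]; abel
  | single p r => simp [evalAt_single]

/-- Words act linearly, so a scalar on `m` passes through them and lands to the right of the
coefficients of `f`. For noncommutative `R` evaluation is therefore only additive in `m`. -/
theorem evalAt_smul (r : R) (m : List E.Letter →₀ R) (f : E.FreeRRing R) :
    evalAt a t R (r • m) f = evalAt a t R m (MulOpposite.op r • f) := by
  induction f using MonoidAlgebra.induction_linear with
  | zero => simp
  | add f g hf hg => simp only [map_add, smul_add, hf, hg]
  | single p s => rw [MonoidAlgebra.smul_single, evalAt_single, evalAt_single, map_smul, smul_smul,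
      op_smul_eq_mul]

theorem evalAt_zero (f : E.FreeRRing R) : evalAt a t R 0 f = 0 := by
  simpa using evalAt_smul a R 0 (0 : List E.Letter →₀ R) f

theorem evalAt_mul (m : List E.Letter →₀ R) (f g : E.FreeRRing R) :
    evalAt a t R m (f * g) = evalAt a t R (evalAt a t R m g) f := by
  induction f using MonoidAlgebra.induction_linear with
  | zero => simp
  | add f f' hf hf' => simp only [map_add, add_mul, hf, hf']
  | single p r =>
    induction g using MonoidAlgebra.induction_linear with
    | zero => simp [evalAt_zero]
    | add g g' hg hg' => simp only [map_add, mul_add, hg, hg', evalAt_add]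
    | single q s =>
      rw [MonoidAlgebra.single_mul_single, evalAt_single, evalAt_single, evalAt_single, map_mul,
        map_smul, smul_smul, Module.End.mul_apply]

theorem evalAt_vert (m : List E.Letter →₀ R) (u : E.Vertex) :
    evalAt a t R m (vert R u) = vertexOp t R u m :=
  evalAt_ofWord a R m _

theorem evalAt_edgeElt (m : List E.Letter →₀ R) (α : E.SEdge) (i : ℕ) :
    evalAt a t R m (edgeElt R α i) = edgeOp a t R α i m := by
  rw [edgeElt]
  split_ifs with h
  · exact evalAt_ofWord a R m _
  · simp [edgeOp_of_le a R (not_lt.1 h)]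

theorem evalAt_ghostElt (m : List E.Letter →₀ R) (α : E.SEdge) (i : ℕ) :
    evalAt a t R m (ghostElt R α i) = ghostOp t R α i m := by
  rw [ghostElt]
  split_ifs with h
  · exact evalAt_ofWord a R m _
  · simp [ghostOp_of_le R (not_lt.1 h)]

theorem letterOp_single_mem (x : E.Letter) {l : List E.Letter} (hl : IsNormalTo a t l) :
    letterOp a t R x (.single l 1) ∈ normalSpan a t R x.src := by
  cases x with
  | vertex u => exact vertexOp_single_mem a R u hl
  | edge α i => exact edgeOp_single_mem a R α i hl
  | ghost α i => exact ghostOp_single_mem a R α i hl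

theorem letterOp_mem (x : E.Letter) {m : List E.Letter →₀ R} (hm : m ∈ normalSpanTo a t R) :
    letterOp a t R x m ∈ normalSpanTo a t R := by
  refine normalSpanTo_induction a R (P := fun m => letterOp a t R x m ∈ normalSpanTo a t R) hm
    (fun l hl => ?_) ?_ (fun m m' hm hm' => ?_) fun r m hm => ?_
  · exact normalSpan_le a t R _ (letterOp_single_mem a R x hl)
  · simp
  · rw [map_add]; exact add_mem hm hm'
  · rw [map_smul]; exact Submodule.smul_mem _ r hm

theorem wordOp_mem (p : E.Word) {m : List E.Letter →₀ R} (hm : m ∈ normalSpanTo a t R) :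
    wordOp a t R p m ∈ normalSpanTo a t R := by
  induction p using FreeSemigroup.recOnMul with
  | ih1 x => exact letterOp_mem a R x hm
  | ih2 x y _ hy =>
    rw [wordOp, FreeSemigroup.lift_of_mul]
    exact letterOp_mem a R x hy

theorem evalAt_mem {m : List E.Letter →₀ R} (hm : m ∈ normalSpanTo a t R) (f : E.FreeRRing R) :
    evalAt a t R m f ∈ normalSpanTo a t R := by
  induction f using MonoidAlgebra.induction_linear with
  | zero => simp
  | add f g hf hg => rw [map_add]; exact add_mem hf hg
  | single p r => rw [evalAt_single]; exact Submodule.smul_mem _ r (wordOp_mem a R p hm)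

/-! ### The ideal of relations annihilates the normal paths -/

variable (t)

/-- The annihilator in the free `R`-ring of the span of the normal paths ending at `t`. -/
noncomputable def annihilatorTo : TwoSidedIdeal (E.FreeRRing R) :=
  .mk' {f | ∀ m ∈ normalSpanTo a t R, evalAt a t R m f = 0} (fun _ _ => map_zero _)
    (fun hf hg m hm => by rw [map_add, hf m hm, hg m hm, add_zero])
    (fun hf m hm => by rw [map_neg, hf m hm, neg_zero])
    (fun hg m hm => by rw [evalAt_mul, hg m hm, evalAt_zero])
    -- Closure under right multiplication is where invariance of the normal span enters.
    (fun hf m hm => by rw [evalAt_mul, hf _ (evalAt_mem a R hm _)])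

variable {t}

theorem mem_annihilatorTo {f : E.FreeRRing R} :
    f ∈ annihilatorTo a t R ↔ ∀ m ∈ normalSpanTo a t R, evalAt a t R m f = 0 :=
  TwoSidedIdeal.mem_mk' ..

theorem isRRingIdeal_annihilatorTo : IsRRingIdeal R (annihilatorTo a t R) := by
  simp only [IsRRingIdeal, mem_annihilatorTo]
  refine ⟨fun r f hf m hm => ?_, fun r f hf m hm => ?_⟩
  · rw [map_smul, hf m hm, smul_zero]
  · rw [← evalAt_smul, hf _ (Submodule.smul_mem _ r hm)]

theorem evalAt_eq_of_leavittRel {f g : E.FreeRRing R} (h : LeavittRel E R f g) {l : List E.Letter}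
    (hl : IsNormalTo a t l) : evalAt a t R (.single l 1) f = evalAt a t R (.single l 1) g := by
  classical
  cases h with
  | vertex_mul_vertex v w =>
    rw [evalAt_mul, evalAt_vert, evalAt_vert]
    have := vertexOp_single_mem (t := t) a R w hl
    split_ifs with hvw
    · subst hvw
      rw [evalAt_vert, vertexOp_of_mem a R this]
    · rw [vertexOp_of_mem_of_ne a R (Ne.symm hvw) this, map_zero]
  | source_mul_edge α i hi =>
    rw [evalAt_mul, evalAt_vert, evalAt_edgeElt,
      vertexOp_of_mem a R (edgeOp_single_mem a R α i hl)]
  | edge_mul_range α i hi =>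
    rw [evalAt_mul, evalAt_vert, evalAt_edgeElt, evalAt_edgeElt]
    by_cases h : pathSource t l = E.range α
    · rw [vertexOp_single_self R h]
    · rw [vertexOp_single_of_ne R h, edgeOp_single_of_ne a R h, map_zero]
  | range_mul_ghost α i hi =>
    rw [evalAt_mul, evalAt_vert, evalAt_ghostElt,
      vertexOp_of_mem a R (ghostOp_single_mem a R α i hl)]
  | ghost_mul_source α i hi =>
    rw [evalAt_mul, evalAt_vert, evalAt_ghostElt, evalAt_ghostElt]
    by_cases h : pathSource t l = E.source α
    · rw [vertexOp_single_self R h]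
    · rw [vertexOp_single_of_ne R h, ghostOp_single_of_ne R h, map_zero]
  | sum_edge_mul_ghost v i j hi hj =>
    simp only [map_sum, evalAt_mul, evalAt_edgeElt, evalAt_ghostElt]
    rw [sum_edgeOp_ghostOp a R i hj hl]
    split_ifs
    · rw [evalAt_vert]
    · rw [map_zero]
  | sum_ghost_mul_edge α β =>
    simp only [map_sum, evalAt_mul, evalAt_edgeElt, evalAt_ghostElt]
    rw [sum_ghostOp_edgeOp a R α β (le_max_right _ _) hl]
    split_ifs
    · rw [evalAt_vert]
    · rw [map_zero]

/-- The relations have coefficients 0 and 1 only, so evaluating their two sides is linear in `m`,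
which fails for general elements. This allows checking them on single normal paths. -/
theorem evalAt_smul_of_leavittRel {f g : E.FreeRRing R} (h : LeavittRel E R f g) (r : R)
    (m : List E.Letter →₀ R) :
    evalAt a t R (r • m) f = r • evalAt a t R m f ∧
      evalAt a t R (r • m) g = r • evalAt a t R m g := by
  cases h <;> constructor <;> (try split_ifs) <;>
    simp only [map_sum, map_smul, map_zero, smul_zero, Finset.smul_sum, evalAt_mul, evalAt_vert,
      evalAt_edgeElt, evalAt_ghostElt]

theorem leavittIdeal_le_annihilatorTo : leavittIdeal E R ≤ annihilatorTo a t R := by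
  refine sInf_le ⟨?_, isRRingIdeal_annihilatorTo a R⟩
  rintro _ ⟨f, g, h, rfl⟩
  refine (mem_annihilatorTo a R).2 fun m hm => ?_
  rw [map_sub, sub_eq_zero]
  refine normalSpanTo_induction a R (P := fun m => evalAt a t R m f = evalAt a t R m g) hm
    (fun l hl => ?_) ?_ (fun m m' hm hm' => ?_) fun r m hm => ?_
  · exact evalAt_eq_of_leavittRel a R h hl
  · rw [evalAt_zero, evalAt_zero]
  · rw [evalAt_add, evalAt_add, hm, hm']
  · rw [(evalAt_smul_of_leavittRel a R h r m).1, (evalAt_smul_of_leavittRel a R h r m).2, hm]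

end

section

variable {E : WeightedGraph.{u₁, u₂}} (a : E.SpecialEdges) (t : E.Vertex)

/-! ### Normal paths as words -/

/-- The word with letters `l`, or the vertex `t` if `l` is empty. -/
def pathWord : List E.Letter → E.Word
  | [] => .of (.vertex t)
  | x :: l => ⟨x, l⟩

variable {a t}

theorem IsNormalTo.isChain {l : List E.Letter} (hl : IsNormalTo a t l) :
    (∀ x ∈ l, ¬ x.IsVertex) ∧ l.IsChain (fun x y => x.rng = y.src) ∧
      l.IsChain (fun x y => ¬ IsForbidden a x y) := by
  induction hl with
  | nil => simp
  | cons x l hx hr hf hl ih =>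
    refine ⟨List.forall_mem_cons.2 ⟨hx, ih.1⟩, ih.2.1.cons fun y hy => ?_, ih.2.2.cons hf⟩
    obtain ⟨l', rfl⟩ := List.head?_eq_some_iff.1 hy
    exact hr

theorem exists_isNormalTo_of_isChain {l : List E.Letter} (hv : ∀ x ∈ l, ¬ x.IsVertex)
    (hc : l.IsChain (fun x y => x.rng = y.src))
    (hf : l.IsChain (fun x y => ¬ IsForbidden a x y)) (hl : l ≠ []) : ∃ t, IsNormalTo a t l := by
  induction l with
  | nil => exact absurd rfl hl
  | cons x l ih =>
    rw [List.forall_mem_cons] at hv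
    rw [List.isChain_cons] at hc hf
    cases l with
    | nil => exact ⟨x.rng, .cons _ _ hv.1 rfl hf.1 .nil⟩
    | cons y l =>
      obtain ⟨t, ht⟩ := ih hv.2 hc.2 hf.2 (List.cons_ne_nil _ _)
      exact ⟨t, .cons _ _ hv.1 (hc.1 y rfl) hf.1 ht⟩

theorem isForbidden_iff {x y : E.Letter} :
    IsForbidden a x y ↔ ∃ A : E.Word, (A.IsTypeI a ∨ A.IsTypeII) ∧ A.letters = [x, y] := by
  constructor
  · rintro (⟨α, i, j, v, rfl⟩ | ⟨α, β⟩)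
    · exact ⟨_, .inl ⟨v, i, j, rfl⟩, rfl⟩
    · exact ⟨_, .inr ⟨α, β, rfl⟩, rfl⟩
  · rintro ⟨_, ⟨v, i, j, rfl⟩ | ⟨α, β, rfl⟩, h⟩
    · obtain ⟨hx, h⟩ := List.cons_eq_cons.1 h
      obtain ⟨hy, -⟩ := List.cons_eq_cons.1 h
      rw [← hx, ← hy]
      exact .edge_ghost _ _ _ ⟨v, rfl⟩
    · obtain ⟨hx, h⟩ := List.cons_eq_cons.1 h
      obtain ⟨hy, -⟩ := List.cons_eq_cons.1 h
      rw [← hx, ← hy]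
      exact .ghost_edge _ _

/-- All forbidden words have length two, so avoiding them is a condition on adjacent letters. -/
theorem forall_not_isSubword_iff {p : E.Word} :
    (∀ A : E.Word, A.IsTypeI a ∨ A.IsTypeII → ¬ A.IsSubword p) ↔
      p.letters.IsChain (fun x y => ¬ IsForbidden a x y) := by
  constructor
  · intro h
    refine (List.isChain_isInfix p.letters).imp fun x y hxy hf => ?_
    obtain ⟨A, hA, hA'⟩ := isForbidden_iff.1 hf
    exact h A hA (by rwa [Word.IsSubword, hA'])
  · intro h A hA hs
    have hlet : ∃ x y, A.letters = [x, y] := by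
      rcases hA with ⟨v, i, j, rfl⟩ | ⟨α, β, rfl⟩
      · exact ⟨_, _, rfl⟩
      · exact ⟨_, _, rfl⟩
    obtain ⟨x, y, hxy⟩ := hlet
    rw [Word.IsSubword, hxy] at hs
    exact List.isChain_pair.1 (h.infix hs) (isForbidden_iff.2 ⟨A, hA, hxy⟩)

theorem IsNormalTo.isNormal_pathWord {l : List E.Letter} (hl : IsNormalTo a t l) :
    (pathWord t l).IsNormal a := by
  rw [Word.IsNormal, forall_not_isSubword_iff]
  cases l with
  | nil => exact ⟨.inl ⟨t, rfl⟩, List.isChain_singleton _⟩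
  | cons x l => exact ⟨.inr ⟨hl.isChain.1, hl.isChain.2.1⟩, hl.isChain.2.2⟩

theorem Word.IsNormal.exists_pathWord {p : E.Word} (hp : p.IsNormal a) :
    ∃ t l, IsNormalTo a t l ∧ p = pathWord t l := by
  rw [Word.IsNormal, forall_not_isSubword_iff] at hp
  obtain ⟨⟨v, rfl⟩ | ⟨hv, hc⟩, hf⟩ := hp
  · exact ⟨v, [], .nil, rfl⟩
  · obtain ⟨t, ht⟩ := exists_isNormalTo_of_isChain hv hc hf (List.cons_ne_nil _ _)
    exact ⟨t, _, ht, rfl⟩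

variable (a) {R : Type u₃} [Ring R]

theorem ofWord_mul (p q : E.Word) : ofWord R (p * q) = ofWord R p * ofWord R q := by
  simp [ofWord, MonoidAlgebra.single_mul_single]

theorem edgeElt_fin (α : E.SEdge) (i : Fin (E.weight α)) :
    edgeElt R α i = ofWord R (.of (.edge α i)) := by
  simp [edgeElt]

theorem ghostElt_fin (α : E.SEdge) (i : Fin (E.weight α)) :
    ghostElt R α i = ofWord R (.of (.ghost α i)) := by
  simp [ghostElt]

variable (R) [E.RowFinite]

/-! ### Linear independence -/

theorem letterOp_single_of_isNormalTo {x : E.Letter} {l : List E.Letter}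
    (h : IsNormalTo a t (x :: l)) : letterOp a t R x (.single l 1) = .single (x :: l) 1 := by
  obtain _ | ⟨_, _, hx, hr, hf, hl⟩ := h
  cases x with
  | vertex u => exact absurd ⟨u, rfl⟩ hx
  | edge α i =>
    refine (edgeOp_single_of_not_special a R hr.symm ?_ i).trans (consEdge_single R i.2 l)
    rintro hs j l' rfl
    exact hf _ rfl (.edge_ghost _ _ _ hs)
  | ghost α i =>
    refine (ghostOp_single_of_not_first R hr.symm ?_).trans (consGhost_single R i.2 l)
    rintro h0 β l' rfl
    have : i = ⟨0, E.weight_pos α⟩ := Fin.ext h0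
    subst this
    exact hf _ rfl (.ghost_edge _ _)

theorem letterOp_single_of_ne {x : E.Letter} {l : List E.Letter} (h : pathSource t l ≠ x.rng) :
    letterOp a t R x (.single l 1) = 0 := by
  cases x with
  | vertex u => exact vertexOp_single_of_ne R h
  | edge α i => exact edgeOp_single_of_ne a R h i
  | ghost α i => exact ghostOp_single_of_ne R h i

/-- Building up a normal path letter by letter never triggers a reduction. The base vertex `u` is
needed because all trivial paths have the same empty list. -/
theorem wordOp_pathWord [DecidableEq E.Vertex] (u : E.Vertex) {l : List E.Letter}
    (h : IsNormalTo a t l) :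
    wordOp a u R (pathWord t l) (.single [] 1) = if u = t then .single l 1 else 0 := by
  induction h with
  | nil =>
    split_ifs with h
    · exact vertexOp_single_self R h
    · exact vertexOp_single_of_ne R h
  | cons x l hx hr hf hl ih =>
    have h := hl.cons x l hx hr hf
    cases l with
    | nil =>
      change letterOp a u R x (.single [] 1) = _
      split_ifs with hu
      · subst hu
        exact letterOp_single_of_isNormalTo a R h
      · exact letterOp_single_of_ne a R (fun hu' => hu (hu'.trans hr))
    | cons y l =>
      change wordOp a u R (.of x * pathWord t (y :: l)) _ = _
      rw [map_mul, Module.End.mul_apply, ih]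
      change letterOp a u R x _ = _
      split_ifs with hu
      · subst hu
        exact letterOp_single_of_isNormalTo a R h
      · exact map_zero _

/-- The quotient map as a linear map. -/
noncomputable def mkLinear : E.FreeRRing R →ₗ[R] E.LeavittPathAlgebra R :=
  { LeavittPathAlgebra.mk E R with map_smul' := fun _ _ => rfl }

theorem linearIndependent_normal :
    LinearIndependent R fun p : {p : E.Word // p.IsNormal a} =>
      LeavittPathAlgebra.mk E R (ofWord R p.1) := by
  classical
  rw [linearIndependent_iff]
  intro c hc
  have h1 : mkLinear R (Finsupp.linearCombination R
      (fun p : {p : E.Word // p.IsNormal a} => ofWord R p.1) c) = 0 := by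
    rw [Finsupp.apply_linearCombination]
    exact hc
  have h2 : Finsupp.linearCombination R
      (fun p : {p : E.Word // p.IsNormal a} => ofWord R p.1) c ∈ leavittIdeal E R := by
    simpa using (LeavittPathAlgebra.mk_eq_mk E R (y := 0)).1 (h1.trans (map_zero _).symm)
  ext p
  obtain ⟨t, l, hl, hp⟩ := p.2.exists_pathWord
  have h3 := (mem_annihilatorTo a R).1 (leavittIdeal_le_annihilatorTo (t := t) a R h2) (.single [] 1)
    (Finsupp.single_mem_supported R 1 .nil)
  -- Evaluation at the trivial path at the end of `p`, followed by the coefficient at `l`, is the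
  -- functional dual to `p`: another normal path either ends elsewhere and gives zero, or has a
  -- different list.
  have h4 : ∀ q : {p : E.Word // p.IsNormal a},
      Finsupp.lapply (R := R) l (evalAt a t R (.single [] 1) (ofWord R q.1)) =
        if q = p then (1 : R) else 0 := by
    intro q
    rw [evalAt_ofWord]
    split_ifs with hq
    · rw [hq, hp, wordOp_pathWord a R t hl, if_pos rfl]
      simp
    · obtain ⟨t', l', hl', hq'⟩ := q.2.exists_pathWord
      rw [hq', wordOp_pathWord a R t hl']
      split_ifs with ht
      · have : l' ≠ l := by
          rintro rfl
          exact hq (Subtype.ext (by rw [hq', hp, ht]))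
        simp [this]
      · simp
  have h5 := congrArg (Finsupp.lapply (R := R) l) h3
  rw [Finsupp.apply_linearCombination, Finsupp.apply_linearCombination] at h5
  simpa [Function.comp_def, h4, Finsupp.linearCombination_apply, Finsupp.sum_ite_eq] using h5

/-! ### Spanning -/

variable {R}

theorem mk_eq_of_leavittRel {f g : E.FreeRRing R} (h : LeavittRel E R f g) :
    LeavittPathAlgebra.mk E R f = LeavittPathAlgebra.mk E R g := by
  rw [LeavittPathAlgebra.mk_eq_mk, leavittIdeal, rRingIdealSpan, TwoSidedIdeal.mem_sInf]
  exact fun J hJ => hJ.1 ⟨f, g, h, rfl⟩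

/-- Scalars commute with words, so left multiplication by a word is linear even though `R` need not
be commutative. -/
theorem mk_ofWord_mul_smul (p : E.Word) (r : R) (y : E.LeavittPathAlgebra R) :
    LeavittPathAlgebra.mk E R (ofWord R p) * r • y = r • (LeavittPathAlgebra.mk E R (ofWord R p) * y) := by
  obtain ⟨f, rfl⟩ := LeavittPathAlgebra.mk_surjective E R y
  change LeavittPathAlgebra.mk E R (ofWord R p * r • f) = LeavittPathAlgebra.mk E R (r • (ofWord R p * f))
  congr 1
  induction f using MonoidAlgebra.induction_linear with
  | zero => simp
  | add f g hf hg => simp only [smul_add, mul_add, hf, hg]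
  | single q s => simp [ofWord, MonoidAlgebra.single_mul_single]

theorem mk_vert_mul_letter (x : E.Letter) :
    LeavittPathAlgebra.mk E R (vert R x.src) * LeavittPathAlgebra.mk E R (ofWord R (.of x)) = LeavittPathAlgebra.mk E R (ofWord R (.of x)) := by
  rw [← map_mul]
  cases x with
  | vertex u => exact (mk_eq_of_leavittRel (.vertex_mul_vertex u u)).trans (by rw [if_pos rfl]; rfl)
  | edge α i => simpa [edgeElt_fin, Letter.src, Letter.rng] using mk_eq_of_leavittRel (.source_mul_edge (R := R) α i i.2)
  | ghost α i => simpa [ghostElt_fin, Letter.src, Letter.rng] using mk_eq_of_leavittRel (.range_mul_ghost (R := R) α i i.2)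

theorem mk_letter_mul_vert (x : E.Letter) :
    LeavittPathAlgebra.mk E R (ofWord R (.of x)) * LeavittPathAlgebra.mk E R (vert R x.rng) = LeavittPathAlgebra.mk E R (ofWord R (.of x)) := by
  rw [← map_mul]
  cases x with
  | vertex u => exact (mk_eq_of_leavittRel (.vertex_mul_vertex u u)).trans (by rw [if_pos rfl]; rfl)
  | edge α i => simpa [edgeElt_fin, Letter.src, Letter.rng] using mk_eq_of_leavittRel (.edge_mul_range (R := R) α i i.2)
  | ghost α i => simpa [ghostElt_fin, Letter.src, Letter.rng] using mk_eq_of_leavittRel (.ghost_mul_source (R := R) α i i.2)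

theorem mk_vert_mul_vert_of_ne {u v : E.Vertex} (h : u ≠ v) :
    LeavittPathAlgebra.mk E R (vert R u) * LeavittPathAlgebra.mk E R (vert R v) = 0 := by
  rw [← map_mul, mk_eq_of_leavittRel (.vertex_mul_vertex u v), if_neg h, map_zero]

theorem mk_edgeElt_mul_mk_ghostElt [DecidableEq E.SEdge] {α : E.SEdge} (i j : Fin (E.weight α)) :
    LeavittPathAlgebra.mk E R (edgeElt R α i) * LeavittPathAlgebra.mk E R (ghostElt R α j) =
      (if (i : ℕ) = j then LeavittPathAlgebra.mk E R (vert R (E.source α)) else 0) -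
        ∑ γ ∈ (E.out (E.source α)).erase α,
          LeavittPathAlgebra.mk E R (edgeElt R γ i) * LeavittPathAlgebra.mk E R (ghostElt R γ j) := by
  have hw : E.weight α ≤ E.vertexWeight (E.source α) :=
    Finset.le_sup (f := E.weight) (mem_out.2 rfl)
  have := mk_eq_of_leavittRel
    (.sum_edge_mul_ghost (R := R) (E.source α) i j (i.2.trans_le hw) (j.2.trans_le hw))
  rw [map_sum, ← Finset.add_sum_erase _ _ (mem_out.2 rfl : α ∈ _)] at this
  simp only [map_mul] at this
  rw [eq_sub_iff_add_eq, this]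
  split_ifs
  · rfl
  · exact map_zero _

theorem mk_ghostElt_zero_mul_mk_edgeElt_zero [DecidableEq E.SEdge] (α β : E.SEdge) :
    LeavittPathAlgebra.mk E R (ghostElt R α 0) * LeavittPathAlgebra.mk E R (edgeElt R β 0) =
      (if α = β then LeavittPathAlgebra.mk E R (vert R (E.range α)) else 0) -
        ∑ k ∈ Finset.Ico 1 (E.weight β), LeavittPathAlgebra.mk E R (ghostElt R α k) * LeavittPathAlgebra.mk E R (edgeElt R β k) := by
  have := mk_eq_of_leavittRel (.sum_ghost_mul_edge (R := R) α β)
  rw [← Finset.sum_subset (Finset.range_subset_range.2 (le_max_right _ _)) fun k _ hk => by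
      rw [edgeElt, dif_neg (by simpa using hk), mul_zero],
    Finset.range_eq_Ico, Finset.sum_eq_sum_Ico_succ_bot (E.weight_pos β), map_add, map_sum] at this
  simp only [map_mul] at this
  rw [eq_sub_iff_add_eq, this]
  split_ifs
  · rfl
  · exact map_zero _

/-! ### Comparison of the operators with left multiplication in the algebra -/

variable (t R) in
/-- The map from formal linear combinations of paths ending at `t` to the algebra. -/
noncomputable def pathMap : (List E.Letter →₀ R) →ₗ[R] E.LeavittPathAlgebra R :=
  Finsupp.linearCombination R fun l => LeavittPathAlgebra.mk E R (ofWord R (pathWord t l))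

theorem pathMap_single (l : List E.Letter) :
    pathMap t R (.single l 1) = LeavittPathAlgebra.mk E R (ofWord R (pathWord t l)) := by
  simp [pathMap]

theorem mk_letter_mul_pathMap_single {x : E.Letter} {l : List E.Letter}
    (h : pathSource t l = x.rng) :
    LeavittPathAlgebra.mk E R (ofWord R (.of x)) * pathMap t R (.single l 1) = pathMap t R (.single (x :: l) 1) := by
  rw [pathMap_single, pathMap_single]
  cases l with
  | nil =>
    change t = x.rng at h
    subst h
    exact mk_letter_mul_vert x
  | cons y l =>
    rw [← map_mul, ← ofWord_mul]
    rfl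

theorem mk_vert_mul_pathMap_single (l : List E.Letter) :
    LeavittPathAlgebra.mk E R (vert R (pathSource t l)) * pathMap t R (.single l 1) = pathMap t R (.single l 1) := by
  rw [pathMap_single]
  match l with
  | [] => exact mk_vert_mul_letter (.vertex t)
  | [x] => exact mk_vert_mul_letter x
  | x :: y :: l =>
    change _ * LeavittPathAlgebra.mk E R (ofWord R (.of x * ⟨y, l⟩)) = LeavittPathAlgebra.mk E R (ofWord R (.of x * ⟨y, l⟩))
    rw [ofWord_mul, map_mul, ← mul_assoc]
    congr 1
    exact mk_vert_mul_letter x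

/-- The range of `x` and the source of the path can be inserted between the factors, and distinct
vertices are orthogonal. -/
theorem mk_letter_mul_pathMap_single_of_ne {x : E.Letter} {l : List E.Letter}
    (h : pathSource t l ≠ x.rng) :
    LeavittPathAlgebra.mk E R (ofWord R (.of x)) * pathMap t R (.single l 1) = 0 := by
  rw [← mk_letter_mul_vert, ← mk_vert_mul_pathMap_single, mul_assoc, ← mul_assoc (LeavittPathAlgebra.mk E R (vert R _)),
    mk_vert_mul_vert_of_ne h.symm, zero_mul, mul_zero]

theorem mk_edgeElt_mul_pathMap_single {α : E.SEdge} (i : ℕ) {l : List E.Letter}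
    (h : pathSource t l = E.range α) :
    LeavittPathAlgebra.mk E R (edgeElt R α i) * pathMap t R (.single l 1) =
      pathMap t R (consEdge R α i (.single l 1)) := by
  by_cases hi : i < E.weight α
  · rw [edgeElt, dif_pos hi, consEdge_single R hi]
    exact mk_letter_mul_pathMap_single h
  · simp [edgeElt, hi, consEdge]

theorem mk_ghostElt_mul_pathMap_single {α : E.SEdge} (i : ℕ) {l : List E.Letter}
    (h : pathSource t l = E.source α) :
    LeavittPathAlgebra.mk E R (ghostElt R α i) * pathMap t R (.single l 1) =
      pathMap t R (consGhost R α i (.single l 1)) := by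
  by_cases hi : i < E.weight α
  · rw [ghostElt, dif_pos hi, consGhost_single R hi]
    exact mk_letter_mul_pathMap_single h
  · simp [ghostElt, hi, consGhost]

theorem mk_edgeElt_mul_mk_ghostElt_mul_pathMap_single {γ : E.SEdge} (i j : ℕ) {l : List E.Letter}
    (h : pathSource t l = E.source γ) :
    LeavittPathAlgebra.mk E R (edgeElt R γ i) * LeavittPathAlgebra.mk E R (ghostElt R γ j) * pathMap t R (.single l 1) =
      pathMap t R (consEdge R γ i (consGhost R γ j (.single l 1))) := by
  rw [mul_assoc, mk_ghostElt_mul_pathMap_single j h]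
  by_cases hj : j < E.weight γ
  · rw [consGhost_single R hj]
    exact mk_edgeElt_mul_pathMap_single i rfl
  · simp [consGhost, hj]

theorem mk_ghostElt_mul_mk_edgeElt_mul_pathMap_single {α β : E.SEdge} (k : ℕ) {l : List E.Letter}
    (h : pathSource t l = E.range β) (hs : E.source β = E.source α) :
    LeavittPathAlgebra.mk E R (ghostElt R α k) * LeavittPathAlgebra.mk E R (edgeElt R β k) * pathMap t R (.single l 1) =
      pathMap t R (consGhost R α k (consEdge R β k (.single l 1))) := by
  rw [mul_assoc, mk_edgeElt_mul_pathMap_single k h]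
  by_cases hk : k < E.weight β
  · rw [consEdge_single R hk]
    exact mk_ghostElt_mul_pathMap_single k hs
  · simp [consEdge, hk]

/-- Each reduction built into `letterOp` is one of the relations (3), (4), solved for the forbidden
product, so it is an identity in the algebra. -/
theorem mk_letter_mul_pathMap_of_isNormalTo (x : E.Letter) {l : List E.Letter}
    (hl : IsNormalTo a t l) :
    LeavittPathAlgebra.mk E R (ofWord R (.of x)) * pathMap t R (.single l 1) =
      pathMap t R (letterOp a t R x (.single l 1)) := by
  classical
  by_cases h : pathSource t l = x.rng
  swap
  · rw [letterOp_single_of_ne a R h, map_zero, mk_letter_mul_pathMap_single_of_ne h]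
  cases x with
  | vertex u =>
    change _ = pathMap t R (vertexOp t R u _)
    change pathSource t l = u at h
    rw [vertexOp_single_self R h]
    subst h
    exact mk_vert_mul_pathMap_single l
  | edge α i =>
    change _ = pathMap t R (edgeOp a t R α i _)
    rw [← edgeElt_fin]
    by_cases hs : a.IsSpecial α ∧ ∃ j l', l = .ghost α j :: l'
    swap
    · push Not at hs
      rw [edgeOp_single_of_not_special a R h hs, mk_edgeElt_mul_pathMap_single i h]
    obtain ⟨hα, j, l, rfl⟩ := hs
    obtain _ | ⟨_, _, _, hr, -, -⟩ := hl
    rw [edgeOp_single_special a R hα, ← mk_letter_mul_pathMap_single hr.symm, ← ghostElt_fin,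
      ← mul_assoc, mk_edgeElt_mul_mk_ghostElt, sub_mul, Finset.sum_mul, map_sub, map_sum]
    congr 1
    · split_ifs
      · rw [show E.source α = _ from hr, mk_vert_mul_pathMap_single]
      · rw [zero_mul, map_zero]
    · refine Finset.sum_congr rfl fun γ hγ => ?_
      rw [Finset.mem_erase, mem_out] at hγ
      exact mk_edgeElt_mul_mk_ghostElt_mul_pathMap_single i j (hr.symm.trans hγ.2.symm)
  | ghost α i =>
    change _ = pathMap t R (ghostOp t R α i _)
    rw [← ghostElt_fin]
    by_cases hs : (i : ℕ) = 0 ∧ ∃ β l', l = .edge β ⟨0, E.weight_pos β⟩ :: l'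
    swap
    · push Not at hs
      rw [ghostOp_single_of_not_first R h hs, mk_ghostElt_mul_pathMap_single i h]
    obtain ⟨h0, β, l, rfl⟩ := hs
    obtain _ | ⟨_, _, _, hr, -, -⟩ := hl
    rw [h0, ghostOp_single_first R h, ← mk_letter_mul_pathMap_single hr.symm, ← edgeElt_fin,
      ← mul_assoc, mk_ghostElt_zero_mul_mk_edgeElt_zero, sub_mul, Finset.sum_mul, map_sub, map_sum]
    congr 1
    · split_ifs with hαβ
      · subst hαβ
        rw [show E.range α = _ from hr, mk_vert_mul_pathMap_single]
      · rw [zero_mul, map_zero]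
    · exact Finset.sum_congr rfl fun k _ =>
        mk_ghostElt_mul_mk_edgeElt_mul_pathMap_single k hr.symm h

theorem mk_letter_mul_pathMap (x : E.Letter) {m : List E.Letter →₀ R}
    (hm : m ∈ normalSpanTo a t R) :
    LeavittPathAlgebra.mk E R (ofWord R (.of x)) * pathMap t R m = pathMap t R (letterOp a t R x m) := by
  refine normalSpanTo_induction a R
    (P := fun m => LeavittPathAlgebra.mk E R (ofWord R (.of x)) * pathMap t R m = pathMap t R (letterOp a t R x m)) hm
    (fun l hl => mk_letter_mul_pathMap_of_isNormalTo a x hl) ?_ (fun m m' hm hm' => ?_)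
    fun r m hm => ?_
  · simp only [map_zero, mul_zero]
  · simp only [map_add, mul_add, hm, hm']
  · simp only [map_smul, mk_ofWord_mul_smul, hm]

theorem exists_mk_ofWord_eq_pathMap (p : E.Word) :
    ∃ t, ∃ m ∈ normalSpanTo a t R, LeavittPathAlgebra.mk E R (ofWord R p) = pathMap t R m := by
  induction p using FreeSemigroup.recOnMul with
  | ih1 x =>
    have hm : (.single [] 1 : List E.Letter →₀ R) ∈ normalSpanTo a x.rng R :=
      Finsupp.single_mem_supported R 1 .nil
    -- A letter equals itself times its range, which is the image of the empty list.
    refine ⟨x.rng, _, letterOp_mem a R x hm, ?_⟩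
    rw [← mk_letter_mul_pathMap a x hm, pathMap_single]
    exact (mk_letter_mul_vert x).symm
  | ih2 x y _ hy =>
    obtain ⟨t, m, hm, h⟩ := hy
    refine ⟨t, _, letterOp_mem a R x hm, ?_⟩
    rw [← mk_letter_mul_pathMap a x hm, ← h, ofWord_mul, map_mul]

theorem pathMap_mem_span {m : List E.Letter →₀ R} (hm : m ∈ normalSpanTo a t R) :
    pathMap t R m ∈ Submodule.span R (Set.range fun p : {p : E.Word // p.IsNormal a} =>
      LeavittPathAlgebra.mk E R (ofWord R p.1)) := by
  refine normalSpanTo_induction a R (P := fun m => pathMap t R m ∈ Submodule.span R _) hm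
    (fun l hl => ?_) ?_ (fun m m' hm hm' => ?_) fun r m hm => ?_
  · rw [pathMap_single]
    exact Submodule.subset_span ⟨⟨_, hl.isNormal_pathWord⟩, rfl⟩
  · rw [map_zero]; exact zero_mem _
  · rw [map_add]; exact add_mem hm hm'
  · rw [map_smul]; exact Submodule.smul_mem _ r hm

theorem span_normal_eq_top :
    Submodule.span R (Set.range fun p : {p : E.Word // p.IsNormal a} =>
      LeavittPathAlgebra.mk E R (ofWord R p.1)) = ⊤ := by
  refine eq_top_iff.2 fun y _ => ?_
  obtain ⟨f, rfl⟩ := LeavittPathAlgebra.mk_surjective E R y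
  induction f using MonoidAlgebra.induction_linear with
  | zero => rw [map_zero]; exact zero_mem _
  | add f g hf hg => rw [map_add]; exact add_mem (hf trivial) (hg trivial)
  | single p r =>
    obtain ⟨t, m, hm, h⟩ := exists_mk_ofWord_eq_pathMap (R := R) a p
    rw [show MonoidAlgebra.single p r = r • ofWord R p by simp [ofWord]]
    change r • LeavittPathAlgebra.mk E R (ofWord R p) ∈ _
    rw [h]
    exact Submodule.smul_mem _ r (pathMap_mem_span a hm)

end

end WeightedGraph

theorem theorem2 (R : Type u₃) [Ring R] (E : WeightedGraph.{u₁, u₂}) [E.RowFinite]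
    (a : E.SpecialEdges) :
    ∃ b : Module.Basis {p : E.Word // p.IsNormal a} R (E.LeavittPathAlgebra R),
      ∀ p : {p : E.Word // p.IsNormal a},
        b p = WeightedGraph.LeavittPathAlgebra.mk E R (WeightedGraph.ofWord R p.1) :=
  ⟨.mk (WeightedGraph.linearIndependent_normal a R) (WeightedGraph.span_normal_eq_top a).ge,
    fun _ => Module.Basis.mk_apply ..⟩
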